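/- Let $n\ge 3$ and $k\ge 1$ be integers. Let $S(n;k)$ be the graph obtained from the cycle $C_n$ with vertices $v_1,\dots,v_n$ and from $n$ disjoint paths, each on $k$ vertices, by joining $v_i$ with an edge to a leaf (end vertex) of the $i$-th path, for $i=1,\dots,n$. Let $\overline{S}(n;k)$ be the graph obtained in the same way with the complete graph $K_n$ on $v_1,\dots,v_n$ in place of $C_n$. Both graphs have $n(k+1)$ vertices. For a partition $\lambda$ of the integer $|V(G)|$, a connected partition of type $\lambda$ of a finite simple graph $G$ is a partition of $V(G)$ into nonempty sets, each inducing a connected subgraph of $G$, whose sizes are the parts of $\lambda$. The chromatic symmetric function of $G=(V,E)$ is $X_G=\sum_\kappa\prod_{v\in V}x_{\kappa(v)}$, summed over all proper colourings $\kappa:V\to\mathbb{N}$; the graph $G$ is $e$-positive if all coefficients in the expansion of $X_G$ in the basis $\{e_\lambda\}$ of elementary symmetric functions, $e_\lambda=e_{\lambda_1}e_{\lambda_2}\cdots$, are nonnegative. Theorem. Neither $S(n;k)$ nor $\overline{S}(n;k)$ has a connected partition of the type $\lambda$ given by $$\lambda=\begin{cases}(n+1,\,n-1) & \text{if } k=1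 \text{ and } n \text{ is even},\\[2pt] (n,\,n) & \text{if } k=1 \text{ and } n \text{ is odd},\\[2pt] \left(\frac{n(k+1)}{2}+1,\ \frac{n(k+1)}{2}-1\right) & \text{if } k\ge 2 \text{ and } n(k+1) \text{ is even},\\[4pt] \left(\frac{n(k+1)+1}{2},\ \frac{n(k+1)-1}{2}\right) & \text{if } k\ge 2 \text{ and } n(k+1) \text{ is odd}.\end{cases}$$ Moreover, neither $S(n;k)$ nor $\overline{S}(n;k)$ is $e$-positive. -/

import Mathlib

namespace Suns

/-- The graph obtained from a body graph `H` on the vertices `v_i`, `i : Fin n`, by joining each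
`v_i` with an edge to a leaf of a new path on `l i` vertices (the `i`-th ray).
The vertex `⟨i, 0⟩` is `v_i`, and `⟨i, 1⟩, …, ⟨i, l i⟩` are the successive vertices of the `i`-th
ray, starting with the one that is joined to `v_i`. -/
def sun {n : ℕ} (H : SimpleGraph (Fin n)) (l : Fin n → ℕ) :
    SimpleGraph (Σ i : Fin n, Fin (l i + 1)) where
  Adj p q :=
    (p.1 = q.1 ∧ ((p.2 : ℕ) + 1 = (q.2 : ℕ) ∨ (q.2 : ℕ) + 1 = (p.2 : ℕ))) ∨
      ((p.2 : ℕ) = 0 ∧ (q.2 : ℕ) = 0 ∧ H.Adj p.1 q.1)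
  symm := ⟨by
    rintro p q (⟨h, h'⟩ | ⟨hp, hq, h⟩)
    · exact Or.inl ⟨h.symm, h'.symm⟩
    · exact Or.inr ⟨hq, hp, h.symm⟩⟩
  loopless := ⟨by
    rintro p (⟨-, h | h⟩ | ⟨-, -, h⟩)
    · omega
    · omega
    · exact H.loopless.irrefl _ h⟩

/-- The ordinary sun with `n` rays of the same size `k`: the body is the cycle `C_n`. -/
def ordinarySun (n k : ℕ) : SimpleGraph (Σ _ : Fin n, Fin (k + 1)) :=
  sun (SimpleGraph.cycleGraph n) (fun _ => k)

/-- The complete sun with `n` rays of the same size `k`: the body is the complete graph `K_n`. -/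
def completeSun (n k : ℕ) : SimpleGraph (Σ _ : Fin n, Fin (k + 1)) :=
  sun (SimpleGraph.completeGraph (Fin n)) (fun _ => k)

/-- `G` has a connected partition of type `μ`: the vertex set can be partitioned into (nonempty)
parts which induce connected subgraphs and whose sizes, with multiplicity, are the parts of `μ`. -/
def HasConnectedPartition {V : Type*} [Fintype V] [DecidableEq V] (G : SimpleGraph V)
    {d : ℕ} (μ : d.Partition) : Prop :=
  ∃ P : Finpartition (Finset.univ : Finset V),
    (∀ s ∈ P.parts, (G.induce (s : Set V)).Connected) ∧
      P.parts.val.map Finset.card = μ.parts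

/-- The exponent of the monomial `∏ v, x_{κ v}` of a colouring `κ`. -/
noncomputable def colourExponent {V : Type*} [Fintype V] (κ : V → ℕ) : ℕ →₀ ℕ :=
  ∑ v, Finsupp.single (κ v) 1

/-- Only finitely many colourings have a given monomial. -/
theorem finite_colourings {V : Type*} [Fintype V] (G : SimpleGraph V) (m : ℕ →₀ ℕ) :
    Finite {κ : G.Coloring ℕ // colourExponent (fun v => κ v) = m} := by
  have key : ∀ κ : {κ : G.Coloring ℕ // colourExponent (fun v => κ v) = m}, ∀ v,
      κ.1 v ∈ m.support := by
    rintro ⟨κ, rfl⟩ v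
    simp only [Finsupp.mem_support_iff, ne_eq, colourExponent, Finsupp.finsetSum_apply]
    intro h
    have := Finset.sum_eq_zero_iff.mp h v (Finset.mem_univ v)
    simp at this
  refine Finite.of_injective (β := V → m.support) (fun κ v => ⟨κ.1 v, key κ v⟩) ?_
  intro κ κ' h
  apply Subtype.ext
  apply DFunLike.ext
  intro v
  exact congrArg Subtype.val (congrFun h v)

/-- The chromatic symmetric function `X_G = ∑_κ ∏_v x_{κ v}`, summed over all proper colourings
`κ : V → ℕ`, as a formal power series in `x_0, x_1, x_2, …`: the coefficient of a monomial is the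
(finite) number of proper colourings that have this monomial. -/
noncomputable def chromaticSymmetricFunction {V : Type*} [Fintype V] (G : SimpleGraph V) :
    MvPowerSeries ℕ ℚ :=
  fun m => (Nat.card {κ : G.Coloring ℕ // colourExponent (fun v => κ v) = m} : ℚ)

/-- The elementary symmetric function `e_i = ∑_{j_1 < … < j_i} x_{j_1} ⋯ x_{j_i}` in infinitely
many variables: the sum of all squarefree monomials of degree `i` (so that `e_0 = 1`). -/
noncomputable def elementary (i : ℕ) : MvPowerSeries ℕ ℚ :=
  fun m => if m.degree = i ∧ ∀ j ∈ m.support, m j = 1 then 1 else 0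

/-- The elementary symmetric function `e_μ = ∏ e_{μ_i}` of a partition `μ`. -/
noncomputable def elementaryPart {d : ℕ} (μ : d.Partition) : MvPowerSeries ℕ ℚ :=
  (μ.parts.map elementary).prod

/-- `f` is a (finite) linear combination of the `e_μ`, over partitions `μ` of arbitrary natural
numbers, with nonnegative rational coefficients. -/
def IsEPositive (f : MvPowerSeries ℕ ℚ) : Prop :=
  ∃ c : (Σ d : ℕ, d.Partition) →₀ ℚ,
    (∀ μ, 0 ≤ c μ) ∧ f = c.sum fun μ a => a • elementaryPart μ.2

/-- A graph is `e`-positive if its chromatic symmetric function is. -/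
def GraphEPositive {V : Type*} [Fintype V] (G : SimpleGraph V) : Prop :=
  IsEPositive (chromaticSymmetricFunction G)

end Suns

/-!
The argument rests on Wolfgang's theorem: a connected `e`-positive graph `G` on `N` vertices has
a connected partition of every type `μ` (`Suns.GraphEPositive.exists_connected_blocks`). Suns
have none of the type `λ`, so they are not `e`-positive.

*Connected partitions of suns.* A connected set of more than `k` vertices does not fit inside a
ray without its body vertex, so it contains the body vertex `v_i` of every ray it meets
(`Suns.body_mem_of_connected`). If all blocks of a connected partition have more than `k` elements,
each ray therefore lies in the block of its body vertex, and all sizes are divisible by `k + 1`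
(`Suns.dvd_card_of_connected`). The parts of `λ` are larger than `k`, and their first one is not
divisible by `k + 1`. The body graph plays no role here.

*Wolfgang's theorem.* In terms of power sums, one compares the coefficients of `p_μ`. They are
extracted by specializing the variables: for each block `p`, substitute the `μ p` solutions of
`z ^ μ p = (-1) ^ (μ p + 1)`, each multiplied by an indeterminate `X_p`, and take the coefficient
of `∏ p, X_p ^ μ p`. This linear functional is `Suns.blockCoeff μ`.

* The generating polynomial of the specialized `e_j` is `∏ p, (1 + X_p ^ μ p * z ^ μ p)`, hence
  the functional takes values in the natural numbers on all `e_l`, and it does not vanish on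
  `e_N`. With a single block of size `N` it vanishes on all other `e_l`.
* On `X_G` the functional is a sum over proper colourings by the substituted numbers. If `f` is the
  assignment of blocks and some fibre of `f` is disconnected, rotating the colours on one component
  of this fibre multiplies the part of the sum over `f` by a number other than `1`, so this part
  vanishes. Thus the functional vanishes on `X_G` if there is no connected partition of type `μ`
  (`Suns.coeff_subst_chromaticSymmetricFunction_eq_zero`).
* With a single block of size `N` and `G` connected, the functional does not vanish on `X_G`:
  deletion and contraction, for graphs with weights on the vertices, show that the sum over
  colourings has a definite sign (`Suns.exists_weightedSum_eq`).

By the last point, the coefficient of `e_N` in an expansion of `X_G` with nonnegative coefficients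
is positive, so that the functional of every type `μ` is positive on `X_G`, and `G` has a connected
partition of type `μ`.
-/

/-! ### Weighted sums over proper colourings -/

namespace Suns

/-- `κ` gives distinct colours to adjacent vertices of `G`. -/
def IsProper {V K : Type*} (G : SimpleGraph V) (κ : V → K) : Prop :=
  ∀ a b, G.Adj a b → κ a ≠ κ b

open scoped Classical in
/-- The sum of `∏ v, r (κ v) ^ w v` over all proper colourings `κ` of `G` by the finite set `K`. -/
noncomputable def weightedSum {V K : Type*} [Fintype V] [Fintype K] (G : SimpleGraph V)
    (r : K → ℂ) (w : V → ℕ) : ℂ :=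
  ∑ κ : V → K with IsProper G κ, ∏ v, r (κ v) ^ w v

/-- The map of the vertex set that contracts `v` into `u`. -/
noncomputable def contractMap {V : Type*} {u v : V} (h : u ≠ v) (x : V) : {x : V // x ≠ v} :=
  open scoped Classical in if hx : x = v then ⟨u, h⟩ else ⟨x, hx⟩

theorem contractMap_self {V : Type*} {u v : V} (h : u ≠ v) : contractMap h v = ⟨u, h⟩ := by
  simp [contractMap]

theorem contractMap_of_ne {V : Type*} {u v x : V} (h : u ≠ v) (hx : x ≠ v) :
    contractMap h x = ⟨x, hx⟩ := by
  simp [contractMap, hx]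

theorem connected_map_of_surjective {V W : Type*} {G : SimpleGraph V} (hG : G.Connected)
    {f : V → W} (hf : Function.Surjective f) : (G.map f).Connected := by
  have key : ∀ a b, G.Reachable a b → (G.map f).Reachable (f a) (f b) := by
    rintro a b ⟨p⟩
    induction p with
    | nil => exact .refl _
    | @cons a c b hac _ ih =>
      by_cases h : f a = f c
      · rw [h]; exact ih
      · exact (SimpleGraph.Adj.reachable (G.map_adj_apply' hac h)).trans ih
  have := hG.nonempty
  have : Nonempty W := this.map f
  refine ⟨fun a b => ?_⟩
  obtain ⟨a, rfl⟩ := hf a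
  obtain ⟨b, rfl⟩ := hf b
  exact key _ _ (hG.preconnected a b)

/-- Deletion and contraction of the edge `uv`: a proper colouring of `G - uv` is a proper colouring
of `G` or gives the same colour to `u` and `v`, and then it is a colouring of the contraction, in
which the merged vertex carries both weights. -/
theorem weightedSum_deletion_contraction {V K : Type*} [Fintype V] [Fintype K]
    {G : SimpleGraph V} {u v : V} [Fintype {x : V // x ≠ v}] (huv : G.Adj u v) (r : K → ℂ)
    (w : V → ℕ) (w' : {x : V // x ≠ v} → ℕ) (hu : w' ⟨u, huv.ne⟩ = w u + w v)
    (hw' : ∀ x : {x : V // x ≠ v}, (x : V) ≠ u → w' x = w x) :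
    weightedSum G r w = weightedSum (G.deleteEdges {s(u, v)}) r w -
      weightedSum (G.map (contractMap huv.ne)) r w' := by
  classical
  have hne := huv.ne
  have hdel : ∀ κ : V → K, IsProper (G.deleteEdges {s(u, v)}) κ →
      κ u ≠ κ v → IsProper G κ := by
    intro κ h h' a b hab
    by_cases he : s(a, b) = s(u, v)
    · rcases Sym2.eq_iff.1 he with ⟨rfl, rfl⟩ | ⟨rfl, rfl⟩
      · exact h'
      · exact h'.symm
    · exact h a b (by simpa [SimpleGraph.deleteEdges_adj, hab] using he)
  have e1 : weightedSum (G.deleteEdges {s(u, v)}) r w = weightedSum G r w +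
      ∑ κ : V → K with IsProper (G.deleteEdges {s(u, v)}) κ ∧ κ u = κ v,
        ∏ x, r (κ x) ^ w x := by
    unfold weightedSum
    rw [← Finset.sum_filter_not_add_sum_filter _ (fun κ : V → K => κ u = κ v),
      Finset.filter_filter, Finset.filter_filter]
    congr 2
    ext κ
    simp only [Finset.mem_filter, Finset.mem_univ, true_and]
    exact ⟨fun h => hdel κ h.1 h.2, fun h => ⟨fun a b hab =>
      h a b (SimpleGraph.deleteEdges_le _ hab), h u v huv⟩⟩
  have e2 : weightedSum (G.map (contractMap hne)) r w' =
      ∑ κ : V → K with IsProper (G.deleteEdges {s(u, v)}) κ ∧ κ u = κ v,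
        ∏ x, r (κ x) ^ w x := by
    unfold weightedSum
    refine Finset.sum_bij' (fun κ _ => κ ∘ contractMap hne) (fun κ _ x => κ x) ?_ ?_ ?_ ?_ ?_
    · intro κ hκ
      simp only [Finset.mem_filter, Finset.mem_univ, true_and] at hκ ⊢
      refine ⟨fun a b hab => hκ _ _ (G.map_adj_apply' (SimpleGraph.deleteEdges_le _ hab) ?_), ?_⟩
      · rw [SimpleGraph.deleteEdges_adj] at hab
        obtain ⟨hab, he⟩ := hab
        have hab' := hab.ne
        intro h
        apply he
        by_cases ha : a = v <;> by_cases hb : b = v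
        · exact absurd (ha.trans hb.symm) hab'
        · subst ha
          rw [contractMap_self, contractMap_of_ne _ hb] at h
          simp only [Subtype.mk.injEq] at h
          subst h
          exact Sym2.eq_swap
        · subst hb
          rw [contractMap_self, contractMap_of_ne _ ha] at h
          simp only [Subtype.mk.injEq] at h
          subst h
          rfl
        · rw [contractMap_of_ne _ ha, contractMap_of_ne _ hb] at h
          exact absurd (congrArg Subtype.val h) hab'
      · simp [contractMap_self, contractMap_of_ne _ hne]
    · intro κ hκ
      simp only [Finset.mem_filter, Finset.mem_univ, true_and] at hκ ⊢
      have hκc : ∀ a, κ (contractMap hne a) = κ a := by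
        intro a
        by_cases ha : a = v
        · subst ha; rw [contractMap_self]; exact hκ.2
        · rw [contractMap_of_ne _ ha]
      rintro _ _ ⟨hne', a, b, hab, rfl, rfl⟩
      change κ (contractMap hne a) ≠ κ (contractMap hne b)
      rw [hκc, hκc]
      refine hκ.1 a b ?_
      rw [SimpleGraph.deleteEdges_adj]
      refine ⟨hab, fun he => hne' ?_⟩
      rcases Sym2.eq_iff.1 he with ⟨rfl, rfl⟩ | ⟨rfl, rfl⟩ <;>
      simp [contractMap_self, contractMap_of_ne _ hne]
    · intro κ _
      funext x
      simp [contractMap_of_ne _ x.2]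
    · intro κ hκ
      simp only [Finset.mem_filter, Finset.mem_univ, true_and] at hκ
      funext a
      by_cases ha : a = v
      · subst ha; simp [contractMap_self, hκ.2]
      · simp [contractMap_of_ne _ ha]
    · intro κ _
      rw [← Finset.mul_prod_erase _ _ (Finset.mem_univ v),
        Finset.prod_subtype (Finset.univ.erase v) (p := fun x => x ≠ v) (by simp),
        ← Finset.mul_prod_erase Finset.univ _ (Finset.mem_univ (⟨u, hne⟩ : {x : V // x ≠ v})),
        ← Finset.mul_prod_erase Finset.univ (fun x : {x : V // x ≠ v} => _)
          (Finset.mem_univ (⟨u, hne⟩ : {x : V // x ≠ v})), ← mul_assoc]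
      congr 1
      · simp only [Function.comp, contractMap_self, contractMap_of_ne _ hne, hu, pow_add]
        ring
      · refine Finset.prod_congr rfl fun x hx => ?_
        rw [hw' x (fun h => Finset.ne_of_mem_erase hx (Subtype.ext h))]
        simp [contractMap_of_ne _ x.2]
  rw [e1, e2]
  ring

/-- Suppose that the power sums of `r` of degrees between `0` and `N` vanish and that the weights
add up to `N`. Up to the sign `(-1) ^ (|V| - 1)`, the weighted colouring sum is a natural multiple
of the power sum of degree `N`, and the multiple is positive if the graph is connected. -/
theorem exists_weightedSum_eq {K : Type*} [Fintype K] (r : K → ℂ) (N : ℕ)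
    (h0 : ∀ m, 0 < m → m < N → ∑ x, r x ^ m = 0) {V : Type*} [Fintype V] [Nonempty V]
    (G : SimpleGraph V) (w : V → ℕ) (hw : ∀ v, 0 < w v) (hN : ∑ v, w v = N) :
    ∃ t : ℕ, weightedSum G r w = (-1) ^ (Fintype.card V + 1) * t * ∑ x, r x ^ N ∧
      (G.Connected → 0 < t) := by
  classical
  induction hn : Fintype.card V generalizing V with
  | zero => exact absurd hn Fintype.card_ne_zero
  | succ n ih =>
  induction G using WellFoundedLT.induction with
  | ind G ihG =>
  by_cases hG : ∃ u v, G.Adj u v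
  -- deletion does not change the sign and contraction reverses it, so the two terms add up
  · obtain ⟨u, v, huv⟩ := hG
    have : Nonempty {x : V // x ≠ v} := ⟨⟨u, huv.ne⟩⟩
    have hc : Fintype.card {x : V // x ≠ v} = n := by
      simp [Fintype.card_subtype_compl, hn]
    obtain ⟨t₁, h₁, -⟩ := ihG (G.deleteEdges {s(u, v)}) (lt_of_le_of_ne
      (SimpleGraph.deleteEdges_le _) (fun h => by
        have := huv; rw [← h, SimpleGraph.deleteEdges_adj] at this; simp at this))
    obtain ⟨t₂, h₂, hp⟩ := ih (G.map (contractMap huv.ne))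
      (fun x => if (x : V) = u then w u + w v else w x)
      (fun x => by split_ifs <;> simp [hw])
      (by
        rw [← hN, ← Finset.add_sum_erase Finset.univ w (Finset.mem_univ v),
          Finset.sum_subtype (Finset.univ.erase v) (p := fun x => x ≠ v) (by simp),
          ← Finset.add_sum_erase Finset.univ _ (Finset.mem_univ (⟨u, huv.ne⟩ : {x : V // x ≠ v})),
          ← Finset.add_sum_erase Finset.univ (fun x : {x : V // x ≠ v} => w x)
          (Finset.mem_univ (⟨u, huv.ne⟩ : {x : V // x ≠ v})), ← add_assoc]
        congr 1
        · simp [add_comm]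
        · refine Finset.sum_congr rfl fun x hx => ?_
          rw [if_neg fun h => Finset.ne_of_mem_erase hx (Subtype.ext h)]) hc
    refine ⟨t₁ + t₂, ?_, fun hconn => ?_⟩
    · rw [weightedSum_deletion_contraction huv r w
        (fun x => if (x : V) = u then w u + w v else w x) (by simp) (fun x hx => if_neg hx), h₁, h₂]
      push_cast
      ring
    · have := hp (connected_map_of_surjective hconn fun x => ⟨x, contractMap_of_ne _ x.2⟩)
      omega
  -- without edges, the sum is a product of power sums, which have degree below `N` unless there
  -- is only one vertex
  · push Not at hG
    have hsum : weightedSum G r w = ∏ v, ∑ x, r x ^ w v := by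
      rw [weightedSum, Finset.filter_true_of_mem (fun κ _ a b h => absurd h (hG a b)),
        Finset.prod_univ_sum, Fintype.piFinset_univ]
    by_cases hn0 : n = 0
    · subst hn0
      obtain ⟨a, ha⟩ := Fintype.card_eq_one_iff.1 hn
      have : Unique V := ⟨⟨a⟩, ha⟩
      refine ⟨1, ?_, fun _ => one_pos⟩
      rw [hsum, ← hN]
      simp
    · refine ⟨0, ?_, fun hconn => ?_⟩
      · obtain ⟨a⟩ := ‹Nonempty V›
        obtain ⟨b, hb⟩ := Fintype.exists_ne_of_one_lt_card (by omega) a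
        have hlt : w a < N := by
          rw [← hN, ← Finset.add_sum_erase _ _ (Finset.mem_univ a)]
          have := Finset.single_le_sum (f := w) (fun _ _ => Nat.zero_le _)
            (Finset.mem_erase.2 ⟨hb, Finset.mem_univ b⟩)
          have := hw b
          omega
        rw [hsum, Finset.prod_eq_zero (Finset.mem_univ a) (h0 _ (hw a) hlt)]
        simp
      · have : Nontrivial V := Fintype.one_lt_card_iff_nontrivial.1 (by omega)
        obtain ⟨a⟩ := ‹Nonempty V›
        obtain ⟨b, hb⟩ := hconn.preconnected.exists_adj_of_nontrivial a
        exact absurd hb (hG a b)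

end Suns

/-! ### Evaluation of symmetric functions at a finite alphabet -/

namespace Suns

/-- An enumeration of a finite set of colours by natural numbers. -/
noncomputable def colourIndex (K : Type*) [Fintype K] : K ↪ ℕ :=
  (Fintype.equivFin K).toEmbedding.trans Fin.valEmbedding

/-- The values given to the variables `x_0, x_1, …`: the finitely many variables indexed by `K`
through `colourIndex` receive the values `y`, all others vanish. -/
noncomputable def alphabet {K R : Type*} [Fintype K] [Zero R] (y : K → R) : ℕ → R :=
  Function.extend (colourIndex K) y fun _ => 0

theorem alphabet_colourIndex {K R : Type*} [Fintype K] [Zero R] (y : K → R) (x : K) :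
    alphabet y (colourIndex K x) = y x :=
  (colourIndex K).injective.extend_apply y (fun _ => 0) x

theorem alphabet_of_notMem {K R : Type*} [Fintype K] [Zero R] (y : K → R) {i : ℕ}
    (hi : i ∉ Set.range (colourIndex K)) : alphabet y i = 0 :=
  Function.extend_apply' y (fun _ => 0) i hi

variable {K ι : Type*} [Fintype K]

theorem hasSubst_alphabet {y : K → MvPowerSeries ι ℂ}
    (hy : ∀ x, MvPowerSeries.constantCoeff (y x) = 0) : MvPowerSeries.HasSubst (alphabet y) where
  const_coeff i := by
    by_cases hi : i ∈ Set.range (colourIndex K)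
    · obtain ⟨x, rfl⟩ := hi
      rw [alphabet_colourIndex, hy]
      exact IsNilpotent.zero
    · rw [alphabet_of_notMem y hi, map_zero]
      exact IsNilpotent.zero
  coeff_zero d := by
    refine (Set.finite_range (colourIndex K)).subset fun i hi => ?_
    by_contra h
    exact hi (by rw [alphabet_of_notMem y h, map_zero])

/-- If the coefficients of `f` count the elements of a finite set by their exponents, then `f`
is evaluated at the alphabet `y` by summing over this set. -/
theorem subst_alphabet_eq_sum {y : K → MvPowerSeries ι ℂ}
    (hy : ∀ x, MvPowerSeries.constantCoeff (y x) = 0) {T : Type*} [Fintype T]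
    (f : MvPowerSeries ℕ ℚ) (ex : T → ℕ →₀ ℕ)
    (hf : ∀ d : ℕ →₀ ℕ, (d.support : Set ℕ) ⊆ Set.range (colourIndex K) →
      MvPowerSeries.coeff d f = Nat.card {t // ex t = d}) :
    MvPowerSeries.subst (alphabet y) f = ∑ t, (ex t).prod fun i e => alphabet y i ^ e := by
  classical
  ext e
  rw [MvPowerSeries.coeff_subst (hasSubst_alphabet hy), map_sum,
    finsum_eq_sum_of_support_subset (s := Finset.univ.image ex)]
  · rw [Finset.sum_comp (fun d : ℕ →₀ ℕ =>
      MvPowerSeries.coeff e (d.prod fun i e => alphabet y i ^ e)) ex]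
    refine Finset.sum_congr rfl fun d _ => ?_
    by_cases hd : (d.support : Set ℕ) ⊆ Set.range (colourIndex K)
    · rw [hf d hd, Nat.card_eq_fintype_card, Fintype.card_subtype, Nat.cast_smul_eq_nsmul]
    · obtain ⟨i, hi, hi'⟩ := Set.not_subset.1 hd
      rw [Finsupp.prod, Finset.prod_eq_zero hi]
      · simp
      · rw [alphabet_of_notMem y hi', zero_pow (Finsupp.mem_support_iff.1 hi)]
  · intro d hd
    rw [Function.mem_support] at hd
    have hd' : (d.support : Set ℕ) ⊆ Set.range (colourIndex K) := by
      by_contra h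
      obtain ⟨i, hi, hi'⟩ := Set.not_subset.1 h
      apply hd
      rw [Finsupp.prod, Finset.prod_eq_zero hi]
      · simp
      · rw [alphabet_of_notMem y hi', zero_pow (Finsupp.mem_support_iff.1 hi)]
    rw [hf d hd'] at hd
    have : Nat.card {t // ex t = d} ≠ 0 := by
      intro h; rw [h] at hd; simp at hd
    obtain ⟨⟨t, ht⟩, -⟩ := Nat.card_ne_zero.1 this
    simp only [Finset.coe_image, Finset.coe_univ, Set.image_univ, Set.mem_range]
    exact ⟨t, ht⟩

theorem prod_alphabet_sum_single {y : K → MvPowerSeries ι ℂ} {α : Type*} (s : Finset α)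
    (κ : α → K) :
    ((∑ v ∈ s, Finsupp.single (colourIndex K (κ v)) 1).prod fun i e => alphabet y i ^ e) =
      ∏ v ∈ s, y (κ v) := by
  rw [← Finsupp.prod_finsetSum_index (fun _ => pow_zero _) (fun _ _ _ => pow_add _ _ _)]
  refine Finset.prod_congr rfl fun v _ => ?_
  rw [Finsupp.prod_single_index (h := fun i e => alphabet y i ^ e) (pow_zero _), pow_one,
    alphabet_colourIndex]

open scoped Classical in
theorem subst_chromaticSymmetricFunction {y : K → MvPowerSeries ι ℂ}
    (hy : ∀ x, MvPowerSeries.constantCoeff (y x) = 0) {V : Type*} [Fintype V]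
    (G : SimpleGraph V) :
    MvPowerSeries.subst (alphabet y) (chromaticSymmetricFunction G) =
      ∑ κ : V → K with IsProper G κ, ∏ v, y (κ v) := by
  rw [subst_alphabet_eq_sum hy (T := {κ : V → K // IsProper G κ}) _
    (fun κ => colourExponent fun v => colourIndex K (κ.1 v))]
  · rw [Finset.sum_subtype (p := fun κ : V → K => IsProper G κ) _ (by simp)]
    exact Finset.sum_congr rfl fun κ _ => prod_alphabet_sum_single _ _
  · intro d hd
    change ((Nat.card _ : ℕ) : ℚ) = _
    congr 1
    symm
    refine Nat.card_eq_of_bijective (fun κ => ⟨SimpleGraph.Coloring.mk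
      (fun v => colourIndex K (κ.1.1 v)) fun {a b} hab h =>
        κ.1.2 a b hab ((colourIndex K).injective h), κ.2⟩) ⟨?_, ?_⟩
    · intro κ κ' h
      apply Subtype.ext
      apply Subtype.ext
      funext v
      exact (colourIndex K).injective (DFunLike.congr_fun (congrArg Subtype.val h) v)
    · rintro ⟨κ, hκ⟩
      have hr : ∀ v, ∃ x, colourIndex K x = κ v := by
        intro v
        apply hd
        rw [← hκ]
        simp only [Finset.mem_coe, Finsupp.mem_support_iff, ne_eq, colourExponent,
          Finsupp.finsetSum_apply]
        intro h
        have := Finset.sum_eq_zero_iff.mp h v (Finset.mem_univ v)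
        simp at this
      choose c hc using hr
      refine ⟨⟨⟨c, fun a b hab h => κ.valid hab ?_⟩, ?_⟩, ?_⟩
      · rw [← hc, ← hc, h]
      · simp only [hc, hκ]
      · apply Subtype.ext
        apply DFunLike.ext
        intro v
        exact hc v

theorem subst_elementary {y : K → MvPowerSeries ι ℂ}
    (hy : ∀ x, MvPowerSeries.constantCoeff (y x) = 0) (j : ℕ) :
    MvPowerSeries.subst (alphabet y) (elementary j) =
      ∑ s ∈ Finset.powersetCard j Finset.univ, ∏ x ∈ s, y x := by
  classical
  have hval : ∀ (s : Finset K) x, (∑ x ∈ s, Finsupp.single (colourIndex K x) 1)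
      (colourIndex K x) = if x ∈ s then 1 else 0 := by
    intro s x
    simp [Finsupp.finsetSum_apply, Finsupp.single_apply]
  rw [subst_alphabet_eq_sum hy (T := {s : Finset K // s.card = j}) _
    (fun s => ∑ x ∈ s.1, Finsupp.single (colourIndex K x) 1)]
  · rw [Finset.sum_subtype (p := fun s : Finset K => s.card = j) _ (by simp)]
    exact Finset.sum_congr rfl fun s _ => prod_alphabet_sum_single _ _
  · intro d hd
    change (if _ then _ else _) = _
    have hsub : Subsingleton {t : {s : Finset K // s.card = j} //
        ∑ x ∈ t.1, Finsupp.single (colourIndex K x) 1 = d} := by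
      refine ⟨fun s t => ?_⟩
      apply Subtype.ext
      apply Subtype.ext
      ext x
      have := DFunLike.congr_fun (s.2.trans t.2.symm) (colourIndex K x)
      rw [hval, hval] at this
      split_ifs at this <;> simp_all
    split_ifs with h
    · rw [eq_comm, Nat.cast_eq_one, Nat.card_eq_one_iff_unique]
      refine ⟨hsub, ?_⟩
      have hd' : ∑ x with d (colourIndex K x) ≠ 0, Finsupp.single (colourIndex K x) 1 = d := by
        ext i
        by_cases hi : i ∈ Set.range (colourIndex K)
        · obtain ⟨x, rfl⟩ := hi
          rw [hval]
          by_cases hx : d (colourIndex K x) = 0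
          · simp [hx]
          · simp [h.2 _ (Finsupp.mem_support_iff.2 hx)]
        · have : d i = 0 := by
            by_contra h'
            exact hi (hd (Finsupp.mem_support_iff.2 h'))
          rw [this, Finsupp.finsetSum_apply]
          refine Finset.sum_eq_zero fun x _ => ?_
          rw [Finsupp.single_apply, if_neg fun h' => hi ⟨x, h'⟩]
      refine ⟨⟨⟨_, ?_⟩, hd'⟩⟩
      change (Finset.univ.filter fun x => d (colourIndex K x) ≠ 0).card = j
      have := h.1
      rw [← hd', map_sum] at this
      simpa using this
    · rw [eq_comm, Nat.cast_eq_zero, Nat.card_eq_zero]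
      refine Or.inl ⟨fun s => h ?_⟩
      rw [← s.2]
      refine ⟨?_, ?_⟩
      · rw [map_sum]
        simpa using s.1.2
      · intro i hi
        have hi' : i ∈ Set.range (colourIndex K) := hd (by rw [← s.2]; exact hi)
        obtain ⟨x, rfl⟩ := hi'
        rw [Finsupp.mem_support_iff] at hi
        rw [hval] at hi ⊢
        split_ifs at hi ⊢ <;> simp_all

end Suns

/-! ### Colours given by roots of unity -/

namespace Suns

noncomputable instance fintypeRootsOfUnity (n : ℕ) [NeZero n] : Fintype (rootsOfUnity n ℂ) :=
  Fintype.ofFinite _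

/-- A complex number whose `n`-th power is `(-1) ^ (n + 1)`. -/
noncomputable def signRoot (n : ℕ) [NeZero n] : ℂ :=
  (IsAlgClosed.exists_pow_nat_eq ((-1 : ℂ) ^ (n + 1)) (NeZero.pos n)).choose

theorem signRoot_pow (n : ℕ) [NeZero n] : signRoot n ^ n = (-1) ^ (n + 1) :=
  (IsAlgClosed.exists_pow_nat_eq ((-1 : ℂ) ^ (n + 1)) (NeZero.pos n)).choose_spec

theorem signRoot_ne_zero (n : ℕ) [NeZero n] : signRoot n ≠ 0 := by
  intro h
  have := signRoot_pow n
  rw [h, zero_pow (NeZero.ne n)] at this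
  exact pow_ne_zero _ (by norm_num) this.symm

/-- As `g` runs over the `n`-th roots of unity, `signRoot n * g` runs over the solutions of
`z ^ n = (-1) ^ (n + 1)`. -/
theorem prod_rootsOfUnity_one_add_smul {S : Type*} [CommRing S] [Algebra ℂ S] (n : ℕ) [NeZero n]
    (t : S) : ∏ g : rootsOfUnity n ℂ, (1 + (signRoot n * ((g : ℂˣ) : ℂ)) • t) = 1 + t ^ n := by
  have key : ∏ g : rootsOfUnity n ℂ,
      (1 + (signRoot n * ((g : ℂˣ) : ℂ)) • (Polynomial.X : Polynomial ℂ)) =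
        1 + Polynomial.X ^ n := by
    refine Polynomial.funext fun z => ?_
    have h := (Complex.isPrimitiveRoot_exp n (NeZero.ne n)).pow_sub_pow_eq_prod_sub_mul
      1 (-(signRoot n * z)) (NeZero.pos n)
    rw [one_pow, neg_pow, mul_pow, signRoot_pow, ← mul_assoc, ← pow_add,
      Odd.neg_one_pow ⟨n, by ring⟩] at h
    simp only [Polynomial.eval_prod, Polynomial.eval_add, Polynomial.eval_one,
      Polynomial.eval_smul, Polynomial.eval_X, Polynomial.eval_pow, smul_eq_mul]
    rw [show 1 + z ^ n = 1 - -1 * z ^ n by ring, h]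
    refine Finset.prod_bij (fun g _ => ((g : ℂˣ) : ℂ)) ?_ ?_ ?_ ?_
    · intro g _
      rw [Polynomial.mem_nthRootsFinset (NeZero.pos n)]
      exact congrArg Units.val ((mem_rootsOfUnity n _).1 g.2)
    · intro g _ g' _ h
      exact Subtype.ext (Units.ext h)
    · intro b hb
      rw [Polynomial.mem_nthRootsFinset (NeZero.pos n)] at hb
      exact ⟨rootsOfUnity.mkOfPowEq b hb, Finset.mem_univ _, rfl⟩
    · intro g _
      ring
  have := congrArg (Polynomial.aeval t) key
  simpa using this

theorem coeff_prod_one_add_C_mul_X {K R : Type*} [Fintype K] [CommSemiring R] (y : K → R) (j : ℕ) :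
    (∏ x, (1 + Polynomial.C (y x) * Polynomial.X)).coeff j =
      ∑ s ∈ Finset.powersetCard j Finset.univ, ∏ x ∈ s, y x := by
  classical
  rw [Finset.prod_one_add, Polynomial.finsetSum_coeff, Finset.powersetCard_eq_filter,
    Finset.sum_filter]
  refine Finset.sum_congr rfl fun s _ => ?_
  rw [Finset.prod_mul_distrib, Finset.prod_const, ← map_prod, Polynomial.coeff_C_mul_X_pow]
  simp only [eq_comm]

variable {ι : Type*} (μ : ι → ℕ) [∀ p, NeZero (μ p)]

/-- The colours: a block `p` consists of `μ p` colours, indexed by roots of unity. -/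
abbrev Colour := Σ p : ι, rootsOfUnity (μ p) ℂ

variable {μ} in
/-- The complex number attached to a colour. In the block `p` these are the roots of
`z ^ μ p = (-1) ^ (μ p + 1)`, so that their elementary symmetric functions vanish except for the
first and the last one, which are `1`. -/
noncomputable def colourValue (x : Colour μ) : ℂ := signRoot (μ x.1) * ((x.2 : ℂˣ) : ℂ)

variable {μ} in
theorem colourValue_ne_zero (x : Colour μ) : colourValue x ≠ 0 :=
  mul_ne_zero (signRoot_ne_zero _) (Units.ne_zero _)

/-- The value of the variable of a colour: its complex number, times an indeterminate that
records the block. -/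
noncomputable def colourSeries (x : Colour μ) : MvPowerSeries ι ℂ :=
  colourValue x • MvPowerSeries.X x.1

theorem constantCoeff_colourSeries (x : Colour μ) :
    MvPowerSeries.constantCoeff (colourSeries μ x) = 0 := by
  rw [colourSeries, ← MvPowerSeries.coeff_zero_eq_constantCoeff_apply, map_smul,
    MvPowerSeries.coeff_zero_X, smul_zero]

/-- A primitive root of unity, as an element of the group of roots of unity. -/
noncomputable def rotationRoot (n : ℕ) [NeZero n] : rootsOfUnity n ℂ :=
  (Complex.isPrimitiveRoot_exp n (NeZero.ne n)).toRootsOfUnity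

theorem isPrimitiveRoot_rotationRoot (n : ℕ) [NeZero n] :
    IsPrimitiveRoot ((rotationRoot n : ℂˣ) : ℂ) n :=
  Complex.isPrimitiveRoot_exp n (NeZero.ne n)

/-- The permutation of the colours that rotates each block. -/
noncomputable def rotate : Equiv.Perm (Colour μ) :=
  Equiv.sigmaCongrRight fun p => Equiv.mulLeft (rotationRoot (μ p))

theorem rotate_fst (x : Colour μ) : (rotate μ x).1 = x.1 := rfl

theorem colourValue_rotate (x : Colour μ) :
    colourValue (rotate μ x) = ((rotationRoot (μ x.1) : ℂˣ) : ℂ) * colourValue x := by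
  change signRoot (μ x.1) * (((rotationRoot (μ x.1) * x.2 : rootsOfUnity (μ x.1) ℂ) : ℂˣ) : ℂ) = _
  rw [Subgroup.coe_mul, Units.val_mul, colourValue]
  ring

open scoped Classical in
/-- If the fibre of `f` over `p` is disconnected, the proper colourings with block assignment `f`
contribute nothing: rotating the colours on a union `C` of components of this fibre multiplies
their sum by `ζ ^ |C|`, where `ζ` has order `μ p > |C|`. -/
theorem sum_prod_colourValue_eq_zero [Fintype ι] {V : Type*} [Fintype V] (G : SimpleGraph V)
    (f : V → ι) (p : ι) (C : Finset V) (hCf : ∀ v ∈ C, f v = p) (hC : C.Nonempty)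
    (hlt : C.card < μ p) (hadj : ∀ a ∈ C, ∀ b ∉ C, f b = p → ¬ G.Adj a b) :
    ∑ κ : V → Colour μ with IsProper G κ ∧ ∀ v, (κ v).1 = f v, ∏ v, colourValue (κ v) = 0 := by
  set S := ∑ κ : V → Colour μ with IsProper G κ ∧ ∀ v, (κ v).1 = f v, ∏ v, colourValue (κ v)
    with hS
  let σ : V → Equiv.Perm (Colour μ) := fun v => if v ∈ C then rotate μ else 1
  have hσ1 : ∀ v x, (σ v x).1 = x.1 := by
    intro v x
    by_cases hv : v ∈ C
    · simp only [σ, if_pos hv, rotate_fst]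
    · simp only [σ, if_neg hv, Equiv.Perm.coe_one, id]
  -- equal colours of adjacent vertices lie in the same block, where both or none are rotated
  have hprop : ∀ κ : V → Colour μ, (∀ v, (κ v).1 = f v) →
      ∀ a b, G.Adj a b → (κ a = κ b ↔ σ a (κ a) = σ b (κ b)) := by
    intro κ hκ a b hab
    by_cases hf : f a = f b
    · by_cases ha : a ∈ C <;> by_cases hb : b ∈ C
      · simp [σ, ha, hb]
      · exact absurd hab (hadj a ha b hb (hf ▸ hCf a ha))
      · exact absurd hab.symm (hadj b hb a ha (hf.trans (hCf b hb)))
      · simp [σ, ha, hb]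
    · refine iff_of_false (fun h => hf ?_) (fun h => hf ?_)
      · rw [← hκ, ← hκ, h]
      · rw [← hκ, ← hκ, ← hσ1 a (κ a), ← hσ1 b (κ b), h]
  have h : S = ((rotationRoot (μ p) : ℂˣ) : ℂ) ^ C.card * S := by
    conv_lhs => rw [hS]
    rw [hS, Finset.mul_sum]
    symm
    refine Finset.sum_equiv (Equiv.piCongrRight σ) ?_ ?_
    · intro κ
      simp only [Finset.mem_filter, Finset.mem_univ, true_and, Equiv.piCongrRight_apply,
        Pi.map_apply, hσ1]
      refine and_congr_left fun hκ => ?_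
      exact forall₃_congr fun a b hab => not_congr (hprop κ hκ a b hab)
    · intro κ hκ
      simp only [Finset.mem_filter, Finset.mem_univ, true_and] at hκ
      simp only [Equiv.piCongrRight_apply, Pi.map_apply]
      have hC' : ((rotationRoot (μ p) : ℂˣ) : ℂ) ^ C.card =
          ∏ v, if v ∈ C then ((rotationRoot (μ p) : ℂˣ) : ℂ) else 1 := by
        rw [Finset.prod_ite_mem, Finset.univ_inter, Finset.prod_const]
      rw [hC', ← Finset.prod_mul_distrib]
      refine Finset.prod_congr rfl fun v _ => ?_
      by_cases hv : v ∈ C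
      · have hp : (κ v).1 = p := (hκ.2 v).trans (hCf v hv)
        subst hp
        simp [σ, hv, colourValue_rotate]
      · simp [σ, hv]
  have hne := (isPrimitiveRoot_rotationRoot (μ p)).pow_ne_one_of_pos_of_lt hC.card_pos.ne' hlt
  by_contra h0
  exact hne (mul_right_cancel₀ h0 (by rw [one_mul]; exact h.symm))

/-- A disconnected induced subgraph has a nonempty proper set of vertices that is separated from
the others, namely a component. -/
theorem exists_separated_of_not_connected {V : Type*} [Fintype V] {G : SimpleGraph V} {s : Set V}
    (hs : s.Nonempty) (h : ¬ (G.induce s).Connected) :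
    ∃ C : Finset V, (∀ v ∈ C, v ∈ s) ∧ C.Nonempty ∧ (∃ v ∈ s, v ∉ C) ∧
      ∀ a ∈ C, ∀ b ∉ C, b ∈ s → ¬ G.Adj a b := by
  classical
  have hpre : ¬ (G.induce s).Preconnected := fun hp => h
    { preconnected := hp, nonempty := hs.to_subtype }
  simp only [SimpleGraph.Preconnected, not_forall] at hpre
  obtain ⟨u, w, huw⟩ := hpre
  refine ⟨Finset.univ.filter fun v => ∃ hv : v ∈ s, (G.induce s).Reachable u ⟨v, hv⟩,
    ?_, ⟨u, ?_⟩, ⟨w, w.2, ?_⟩, ?_⟩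
  · intro v hv
    simp only [Finset.mem_filter, Finset.mem_univ, true_and] at hv
    exact hv.1
  · simp only [Finset.mem_filter, Finset.mem_univ, true_and]
    exact ⟨u.2, .refl _⟩
  · simp only [Finset.mem_filter, Finset.mem_univ, true_and]
    exact fun h => huw h.2
  · intro a ha b hb hbs hab
    simp only [Finset.mem_filter, Finset.mem_univ, true_and] at ha hb
    obtain ⟨has, hra⟩ := ha
    exact hb ⟨hbs, hra.trans (SimpleGraph.Adj.reachable (G := G.induce s)
      (u := ⟨a, has⟩) (v := ⟨b, hbs⟩) hab)⟩

/-- The exponent of `∏ p, X_p ^ μ p`. -/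
noncomputable def blockExponent [Finite ι] (μ : ι → ℕ) : ι →₀ ℕ :=
  Finsupp.equivFunOnFinite.symm μ

open scoped Classical in
theorem coeff_prod_colourSeries [Finite ι] {α : Type*} (s : Finset α) (κ : α → Colour μ) :
    MvPowerSeries.coeff (blockExponent μ) (∏ v ∈ s, colourSeries μ (κ v)) =
      if ∀ p, (s.filter fun v => (κ v).1 = p).card = μ p then ∏ v ∈ s, colourValue (κ v)
        else 0 := by
  have h : ∏ v ∈ s, colourSeries μ (κ v) = (∏ v ∈ s, colourValue (κ v)) •
      MvPowerSeries.monomial (∑ v ∈ s, Finsupp.single (κ v).1 1) (1 : ℂ) := by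
    simp only [colourSeries, Finset.prod_smul]
    congr 1
    induction s using Finset.induction_on with
    | empty => simp [MvPowerSeries.monomial_zero_one]
    | insert a s ha ih =>
      rw [Finset.prod_insert ha, Finset.sum_insert ha, ih, MvPowerSeries.X,
        MvPowerSeries.monomial_mul_monomial, one_mul]
  rw [h, map_smul, MvPowerSeries.coeff_monomial, smul_eq_mul, mul_ite, mul_one, mul_zero]
  congr 1
  rw [eq_iff_iff, DFunLike.ext_iff]
  refine forall_congr' fun p => ?_
  rw [Finsupp.finsetSum_apply, Finset.card_filter, eq_comm]
  simp [blockExponent, Finsupp.single_apply]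

/-- If each assignment of blocks of the sizes `μ` has a disconnected block, all contributions to
the coefficient at `μ` vanish. -/
theorem coeff_subst_chromaticSymmetricFunction_eq_zero [Fintype ι] {V : Type*} [Fintype V]
    (G : SimpleGraph V)
    (h : ∀ f : V → ι, (∀ p, Nat.card {v // f v = p} = μ p) →
      ∃ p, ¬ (G.induce {v | f v = p}).Connected) :
    MvPowerSeries.coeff (blockExponent μ)
      (MvPowerSeries.subst (alphabet (colourSeries μ)) (chromaticSymmetricFunction G)) = 0 := by
  classical
  rw [subst_chromaticSymmetricFunction (constantCoeff_colourSeries μ), map_sum]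
  simp only [coeff_prod_colourSeries]
  -- the colourings are sorted by their block assignment `f`
  rw [← Finset.sum_fiberwise _ (fun (κ : V → Colour μ) v => (κ v).1)]
  refine Finset.sum_eq_zero fun f _ => ?_
  rw [Finset.filter_filter]
  by_cases hf : ∀ p, (Finset.univ.filter fun v => f v = p).card = μ p
  · have hf' : ∀ p, Nat.card {v // f v = p} = μ p := by
      intro p
      rw [← hf p, Nat.card_eq_fintype_card, Fintype.card_subtype]
    obtain ⟨p, hp⟩ := h f hf'
    have hne : {v | f v = p}.Nonempty := by
      have : 0 < Nat.card {v // f v = p} := by rw [hf']; exact NeZero.pos _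
      obtain ⟨⟨v, hv⟩⟩ := (Nat.card_pos_iff.1 this).1
      exact ⟨v, hv⟩
    obtain ⟨C, hCf, hC, ⟨v, hv, hvC⟩, hadj⟩ := exists_separated_of_not_connected hne hp
    rw [← sum_prod_colourValue_eq_zero μ G f p C hCf hC _ hadj]
    · refine Finset.sum_congr ?_ fun κ hκ => ?_
      · ext κ
        simp [funext_iff]
      · simp only [Finset.mem_filter, Finset.mem_univ, true_and] at hκ
        rw [if_pos]
        simp only [hκ.2]
        exact hf
    · rw [← hf p]
      refine Finset.card_lt_card ⟨fun a ha => by simpa using hCf a ha, fun hsub => hvC (hsub ?_)⟩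
      simpa using hv
  -- colourings with other block sizes have another exponent
  · refine Finset.sum_eq_zero fun κ hκ => ?_
    simp only [Finset.mem_filter, Finset.mem_univ, true_and] at hκ
    rw [if_neg]
    intro h'
    apply hf
    rw [← hκ.2]
    exact h'

end Suns

/-! ### Connected partitions of `e`-positive graphs -/

namespace Suns

/-- The generating polynomial of the elementary symmetric functions evaluated at the colours:
each block contributes one factor. Its coefficients are natural numbers, so it is defined over
them. -/
noncomputable def blockPolynomial {ι : Type*} [Fintype ι] (μ : ι → ℕ) :
    Polynomial (MvPowerSeries ι ℕ) :=
  ∏ p, (1 + (Polynomial.C (MvPowerSeries.X p) * Polynomial.X) ^ μ p)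

variable {ι : Type*} [Fintype ι] (μ : ι → ℕ) [∀ p, NeZero (μ p)]

theorem subst_elementary_colourSeries (j : ℕ) :
    MvPowerSeries.subst (alphabet (colourSeries μ)) (elementary j) =
      MvPowerSeries.map (Nat.castRingHom ℂ) ((blockPolynomial μ).coeff j) := by
  rw [subst_elementary (constantCoeff_colourSeries μ), ← coeff_prod_one_add_C_mul_X,
    ← Polynomial.coeff_map]
  congr 1
  rw [Fintype.prod_sigma, blockPolynomial, Polynomial.map_prod]
  refine Finset.prod_congr rfl fun p _ => ?_
  simp only [Polynomial.map_add, Polynomial.map_one, Polynomial.map_pow, Polynomial.map_mul,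
    Polynomial.map_C, Polynomial.map_X, MvPowerSeries.map_X]
  rw [← prod_rootsOfUnity_one_add_smul]
  refine Finset.prod_congr rfl fun g _ => ?_
  rw [colourSeries, ← Polynomial.smul_C, smul_mul_assoc]
  rfl

/-- The linear functional that substitutes the colours for the variables and takes the coefficient
at the exponent `μ`. -/
noncomputable def blockCoeff : MvPowerSeries ℕ ℚ →ₗ[ℚ] ℂ :=
  ((MvPowerSeries.coeff (R := ℂ) (blockExponent μ)).restrictScalars ℚ).comp
    (MvPowerSeries.substAlgHom (R := ℚ)
      (hasSubst_alphabet (constantCoeff_colourSeries μ))).toLinearMap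

theorem blockCoeff_apply (f : MvPowerSeries ℕ ℚ) :
    blockCoeff μ f = MvPowerSeries.coeff (blockExponent μ)
      (MvPowerSeries.subst (alphabet (colourSeries μ)) f) := by
  rw [← MvPowerSeries.coe_substAlgHom (hasSubst_alphabet (constantCoeff_colourSeries μ))]
  rfl

theorem subst_elementaryPart {d : ℕ} (l : d.Partition) :
    MvPowerSeries.subst (alphabet (colourSeries μ)) (elementaryPart l) =
      (l.parts.map fun j => MvPowerSeries.subst (alphabet (colourSeries μ))
        (elementary j)).prod := by
  rw [← MvPowerSeries.coe_substAlgHom (hasSubst_alphabet (constantCoeff_colourSeries μ)),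
    elementaryPart, map_multiset_prod, Multiset.map_map]
  rfl

theorem exists_blockCoeff_elementaryPart_eq {d : ℕ} (l : d.Partition) :
    ∃ t : ℕ, blockCoeff μ (elementaryPart l) = t := by
  refine ⟨MvPowerSeries.coeff (blockExponent μ)
    (l.parts.map fun j => (blockPolynomial μ).coeff j).prod, ?_⟩
  rw [blockCoeff_apply, subst_elementaryPart]
  simp only [subst_elementary_colourSeries]
  rw [← Function.comp_def (MvPowerSeries.map (Nat.castRingHom ℂ)), ← Multiset.map_map,
    ← map_multiset_prod, MvPowerSeries.coeff_map]
  rfl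

omit [Fintype ι] in
theorem card_block (p : ι) : Fintype.card (rootsOfUnity (μ p) ℂ) = μ p := by
  rw [← Nat.card_eq_fintype_card, Complex.card_rootsOfUnity]

/-- The number of colours is the sum `N` of the sizes `μ p`, so `e_N` becomes the product of all
colours. -/
theorem blockCoeff_elementaryPart_ne_zero {d : ℕ} (l : d.Partition)
    (hl : l.parts = {∑ p, μ p}) : blockCoeff μ (elementaryPart l) ≠ 0 := by
  classical
  have hcard : ∑ p, μ p = (Finset.univ : Finset (Colour μ)).card := by
    rw [Finset.card_univ, Fintype.card_sigma]
    simp only [card_block]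
  rw [blockCoeff_apply, subst_elementaryPart, hl, Multiset.map_singleton, Multiset.prod_singleton,
    subst_elementary (constantCoeff_colourSeries μ), hcard, Finset.powersetCard_self,
    Finset.sum_singleton]
  refine (coeff_prod_colourSeries μ Finset.univ id).trans_ne ?_
  rw [if_pos]
  · exact Finset.prod_ne_zero_iff.2 fun x _ => colourValue_ne_zero x
  · intro p
    rw [← card_block μ p, ← Fintype.card_subtype]
    exact Fintype.card_congr (Equiv.sigmaSubtype p)

section OneBlock

variable (N : ℕ) [NeZero N]

/-- With one block, the functional vanishes on all products of elementary symmetric functions but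
`e_N`. -/
theorem parts_eq_of_blockCoeff_ne_zero {d : ℕ} (l : d.Partition)
    (h : blockCoeff (fun _ : Unit => N) (elementaryPart l) ≠ 0) : l.parts = {N} := by
  have hsub : ∀ j, 0 < j → MvPowerSeries.subst (alphabet (colourSeries fun _ : Unit => N))
      (elementary j) = if j = N then MvPowerSeries.X () ^ N else 0 := by
    intro j hj
    rw [subst_elementary_colourSeries, blockPolynomial, Fintype.prod_unique, mul_pow, ← map_pow,
      Polynomial.coeff_add, Polynomial.coeff_C_mul_X_pow, Polynomial.coeff_one, if_neg hj.ne',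
      zero_add]
    split_ifs
    · rw [map_pow, MvPowerSeries.map_X]
    · rw [map_zero]
  rw [blockCoeff_apply, subst_elementaryPart] at h
  have hall : ∀ j ∈ l.parts, j = N := by
    intro j hj
    by_contra hne
    apply h
    rw [Multiset.prod_eq_zero, map_zero]
    rw [Multiset.mem_map]
    exact ⟨j, hj, by rw [hsub j (l.parts_pos hj), if_neg hne]⟩
  obtain ⟨m, hm⟩ : ∃ m, l.parts = Multiset.replicate m N :=
    ⟨_, Multiset.eq_replicate_card.2 hall⟩
  rw [hm, Multiset.map_replicate, Multiset.prod_replicate, hsub N (NeZero.pos N), if_pos rfl,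
    ← pow_mul, MvPowerSeries.coeff_X_pow] at h
  split_ifs at h with he
  · have := DFunLike.congr_fun he ()
    rw [Finsupp.single_eq_same] at this
    have hN : N * 1 = N * m := by rw [mul_one]; exact this
    rw [hm, ← Nat.eq_of_mul_eq_mul_left (NeZero.pos N) hN]
    rfl
  · exact absurd rfl h

/-- Rotating the colours multiplies the power sum by `ζ ^ m`, where `ζ` has order `N`. -/
theorem sum_colourValue_pow_eq_zero (m : ℕ) (hm : 0 < m) (hmN : m < N) :
    ∑ x : Colour (fun _ : Unit => N), colourValue x ^ m = 0 := by
  have h : ∑ x : Colour (fun _ : Unit => N), colourValue x ^ m =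
      ((rotationRoot N : ℂˣ) : ℂ) ^ m * ∑ x : Colour (fun _ : Unit => N), colourValue x ^ m := by
    conv_lhs => rw [← Equiv.sum_comp (rotate fun _ : Unit => N)]
    rw [Finset.mul_sum]
    refine Finset.sum_congr rfl fun x _ => ?_
    rw [colourValue_rotate, mul_pow]
  have hne := (isPrimitiveRoot_rotationRoot N).pow_ne_one_of_pos_of_lt hm.ne' hmN
  by_contra h0
  exact hne (mul_right_cancel₀ h0 (by rw [one_mul]; exact h.symm))

theorem sum_colourValue_pow_ne_zero :
    ∑ x : Colour (fun _ : Unit => N), colourValue x ^ N ≠ 0 := by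
  have h : ∀ x : Colour (fun _ : Unit => N), colourValue x ^ N = (-1) ^ (N + 1) := by
    intro x
    have hx : ((x.2 : ℂˣ) : ℂ) ^ N = 1 := congrArg Units.val ((mem_rootsOfUnity N _).1 x.2.2)
    rw [colourValue, mul_pow, hx, mul_one, signRoot_pow]
  simp only [h]
  rw [Finset.sum_const, nsmul_eq_mul]
  refine mul_ne_zero ?_ (pow_ne_zero _ (by norm_num))
  rw [Nat.cast_ne_zero, Finset.card_univ]
  have : Nonempty (Colour fun _ : Unit => N) := ⟨⟨(), 1⟩⟩
  exact Fintype.card_ne_zero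

/-- With one block, the functional is a weighted sum over colourings with all weights `1`. Since it
only sees `e_N`, this says that `e_N` has a nonzero coefficient for connected graphs. -/
theorem blockCoeff_chromaticSymmetricFunction_ne_zero {V : Type*} [Fintype V] {G : SimpleGraph V}
    (hG : G.Connected) (hN : Fintype.card V = N) :
    blockCoeff (fun _ : Unit => N) (chromaticSymmetricFunction G) ≠ 0 := by
  classical
  have := hG.nonempty
  obtain ⟨t, ht, hpos⟩ := exists_weightedSum_eq
    (fun x : Colour (fun _ : Unit => N) => colourValue x) N (sum_colourValue_pow_eq_zero N) G
    (fun _ => 1) (fun _ => one_pos) (by simp [hN])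
  have h : blockCoeff (fun _ : Unit => N) (chromaticSymmetricFunction G) =
      weightedSum G (fun x : Colour (fun _ : Unit => N) => colourValue x) fun _ => 1 := by
    rw [blockCoeff_apply, subst_chromaticSymmetricFunction (constantCoeff_colourSeries _), map_sum,
      weightedSum]
    refine Finset.sum_congr (by congr) fun κ _ => ?_
    rw [coeff_prod_colourSeries, if_pos (by simp [hN])]
    simp only [pow_one]
  rw [h, ht]
  refine mul_ne_zero (mul_ne_zero (pow_ne_zero _ (by norm_num)) ?_) (sum_colourValue_pow_ne_zero N)
  exact Nat.cast_ne_zero.2 (hpos hG).ne'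

end OneBlock

/-- The vertices of a connected `e`-positive graph can be partitioned into connected blocks of any
given sizes. -/
theorem GraphEPositive.exists_connected_blocks {V : Type*} [Fintype V] {G : SimpleGraph V}
    (hpos : GraphEPositive G) (hG : G.Connected) (hμ : ∑ p, μ p = Fintype.card V) :
    ∃ f : V → ι, (∀ p, Nat.card {v // f v = p} = μ p) ∧
      ∀ p, (G.induce {v | f v = p}).Connected := by
  by_contra! hno
  have := hG.nonempty
  have : NeZero (Fintype.card V) := ⟨Fintype.card_ne_zero⟩
  obtain ⟨c, hc, hX⟩ := hpos
  have hsum : ∀ L : MvPowerSeries ℕ ℚ →ₗ[ℚ] ℂ, L (chromaticSymmetricFunction G) =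
      ∑ l ∈ c.support, (c l : ℂ) * L (elementaryPart l.2) := by
    intro L
    rw [hX, Finsupp.sum, map_sum]
    refine Finset.sum_congr rfl fun l _ => ?_
    rw [map_smul, Rat.smul_def]
  -- the coefficient of `e_N` is positive
  have hne := blockCoeff_chromaticSymmetricFunction_ne_zero (Fintype.card V) hG rfl
  rw [hsum] at hne
  obtain ⟨l, hl, hl'⟩ := Finset.exists_ne_zero_of_sum_ne_zero hne
  have hparts := parts_eq_of_blockCoeff_ne_zero _ _ (right_ne_zero_of_mul hl')
  -- the functional of type `μ` vanishes on the graph, although it is positive on `e_N`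
  choose t ht using fun l : Σ d : ℕ, d.Partition => exists_blockCoeff_elementaryPart_eq μ l.2
  have hzero : ∑ l ∈ c.support, c l * t l = 0 := by
    have h := coeff_subst_chromaticSymmetricFunction_eq_zero μ G hno
    rw [← blockCoeff_apply, hsum] at h
    simp only [ht] at h
    exact_mod_cast h
  have hl0 := (Finset.sum_eq_zero_iff_of_nonneg fun l _ =>
    mul_nonneg (hc l) (Nat.cast_nonneg (t l))).1 hzero l hl
  refine blockCoeff_elementaryPart_ne_zero μ l.2 (by rw [hparts, hμ]) ?_
  rw [ht, (mul_eq_zero.1 hl0).resolve_left (Finsupp.mem_support_iff.1 hl) |> Nat.cast_eq_zero.1,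
    Nat.cast_zero]

end Suns

/-! ### Connected sets of vertices of suns -/

namespace Suns

/-- A property that spreads along the edges inside a connected set spreads to the whole set. -/
theorem forall_mem_of_connected {V : Type*} {G : SimpleGraph V} {S : Set V}
    (hS : (G.induce S).Connected) {P : V → Prop} {a : V} (ha : a ∈ S) (hPa : P a)
    (hP : ∀ x ∈ S, ∀ y ∈ S, G.Adj x y → P x → P y) : ∀ x ∈ S, P x := by
  intro x hx
  obtain ⟨p⟩ := hS.preconnected ⟨a, ha⟩ ⟨x, hx⟩
  have key : ∀ (u v : S), (G.induce S).Walk u v → P u → P v := by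
    intro u v p
    induction p with
    | nil => exact id
    | cons h _ ih => exact fun hu => ih (hP _ (Subtype.prop _) _ (Subtype.prop _) h hu)
  exact key _ _ p hPa

variable {n k : ℕ} {H : SimpleGraph (Fin n)}

/-- A connected set of vertices that is too large to lie inside one ray contains the body vertex
of each ray that it meets. -/
theorem body_mem_of_connected {S : Set (Σ _ : Fin n, Fin (k + 1))}
    (hS : ((sun H fun _ => k).induce S).Connected) (hk : k < S.ncard) {i : Fin n}
    {j : Fin (k + 1)} (hij : ⟨i, j⟩ ∈ S) : ⟨i, 0⟩ ∈ S := by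
  by_contra h0
  -- the set can leave the ray only through its body vertex
  have hfst := forall_mem_of_connected hS (P := fun x => x.1 = i) hij rfl (by
    rintro ⟨x, a⟩ hx ⟨y, b⟩ _ (⟨h, -⟩ | ⟨h, -, -⟩) hxi
    · exact h.symm.trans hxi
    · have ha : a = 0 := Fin.ext h
      subst ha
      obtain rfl : x = i := hxi
      exact absurd hx h0)
  have hsub : S ⊆ Set.range fun a : Fin k => (⟨i, a.succ⟩ : Σ _ : Fin n, Fin (k + 1)) := by
    rintro ⟨x, a⟩ hx
    obtain rfl : x = i := hfst _ hx
    have ha : a ≠ 0 := by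
      rintro rfl
      exact h0 hx
    exact ⟨a.pred ha, by simp⟩
  have h1 := Set.ncard_le_ncard hsub (Set.toFinite _)
  have h2 : (Set.range fun a : Fin k => (⟨i, a.succ⟩ : Σ _ : Fin n, Fin (k + 1))).ncard ≤ k := by
    rw [← Set.image_univ]
    refine (Set.ncard_image_le (Set.toFinite _)).trans ?_
    simp
  omega

/-- If all blocks of a partition into connected sets are too large to lie inside one ray, then
they are unions of rays with their body vertices. -/
theorem dvd_card_of_connected {ι : Type*} (f : (Σ _ : Fin n, Fin (k + 1)) → ι)
    (hf : ∀ v, ((sun H fun _ => k).induce {x | f x = f v}).Connected ∧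
      k < {x | f x = f v}.ncard) (p : ι) : k + 1 ∣ {x | f x = p}.ncard := by
  have h : ∀ i j, f ⟨i, j⟩ = f ⟨i, 0⟩ := fun i j =>
    (body_mem_of_connected (hf ⟨i, j⟩).1 (hf ⟨i, j⟩).2 (j := j) rfl).symm
  have e : {x | f x = p} ≃ {i | f ⟨i, 0⟩ = p} × Fin (k + 1) :=
    { toFun := fun x => (⟨x.1.1, (h x.1.1 x.1.2).symm.trans x.2⟩, x.1.2)
      invFun := fun y => ⟨⟨y.1.1, y.2⟩, (h _ _).trans y.1.2⟩
      left_inv := fun _ => rfl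
      right_inv := fun _ => rfl }
  rw [← Nat.card_coe_set_eq, Nat.card_congr e, Nat.card_prod, Nat.card_fin]
  exact Dvd.intro_left _ rfl

theorem not_hasConnectedPartition_sun {d : ℕ} (μ : d.Partition) (hμ : ∀ a ∈ μ.parts, k < a)
    {a : ℕ} (ha : a ∈ μ.parts) (hdvd : ¬ k + 1 ∣ a) :
    ¬ HasConnectedPartition (sun H fun _ => k) μ := by
  rintro ⟨P, hP, hcard⟩
  have hpart : ∀ s ∈ P.parts, {x | P.part x = s} = (s : Set _) := by
    intro s hs
    ext x
    exact P.part_eq_iff_mem hs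
  have hmem : ∀ v, P.part v ∈ P.parts := fun v => P.part_mem.2 (Finset.mem_univ v)
  have hlt : ∀ s ∈ P.parts, k < s.card := fun s hs =>
    hμ _ (by rw [← hcard]; exact Multiset.mem_map_of_mem _ hs)
  rw [← hcard, Multiset.mem_map] at ha
  obtain ⟨s, hs, rfl⟩ := ha
  apply hdvd
  have := dvd_card_of_connected (H := H) P.part (fun v => by
    rw [hpart _ (hmem v), Set.ncard_coe_finset]
    exact ⟨hP _ (hmem v), hlt _ (hmem v)⟩) s
  rwa [hpart s hs, Set.ncard_coe_finset] at this

theorem sun_connected (hH : H.Connected) : (sun H fun _ => k).Connected := by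
  have h0 : ∀ i (j : Fin (k + 1)), (sun H fun _ => k).Reachable ⟨i, j⟩ ⟨i, 0⟩ := by
    rintro i ⟨j, hj⟩
    induction j with
    | zero => exact .refl _
    | succ j ih =>
      refine SimpleGraph.Reachable.trans (SimpleGraph.Adj.reachable ?_) (ih (by omega))
      exact Or.inl ⟨rfl, Or.inr rfl⟩
  let φ : H →g sun H fun _ => k := ⟨fun i => ⟨i, 0⟩, fun h => Or.inr ⟨rfl, rfl, h⟩⟩
  obtain ⟨i⟩ := hH.nonempty
  have : Nonempty (Σ _ : Fin n, Fin (k + 1)) := ⟨⟨i, 0⟩⟩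
  refine ⟨?_⟩
  rintro ⟨i, j⟩ ⟨i', j'⟩
  exact (h0 i j).trans (((hH.preconnected i i').map φ).trans (h0 i' j').symm)

theorem not_graphEPositive_sun (hH : H.Connected) {a b : ℕ} (hab : a + b = n * (k + 1))
    (ha : k < a) (hb : k < b) (hdvd : ¬ k + 1 ∣ a) : ¬ GraphEPositive (sun H fun _ => k) := by
  intro hpos
  let μ : Bool → ℕ := fun p => cond p a b
  have hμ : ∀ p, k < μ p := by rintro (_ | _) <;> assumption
  have : ∀ p, NeZero (μ p) := fun p => ⟨by have := hμ p; omega⟩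
  obtain ⟨f, hcard, hconn⟩ := hpos.exists_connected_blocks μ (sun_connected hH)
    (by simp [μ, hab])
  have hcard' : ∀ p, {x | f x = p}.ncard = μ p := fun p => by
    rw [← hcard p, ← Nat.card_coe_set_eq]; rfl
  have := dvd_card_of_connected (H := H) f
    (fun v => ⟨hconn _, by rw [hcard']; exact hμ _⟩) true
  rw [hcard'] at this
  exact hdvd this

end Suns

/-! ### The partition type of the theorem -/

theorem mainTheorem1 (n k : ℕ) (hn : 3 ≤ n) (hk : 1 ≤ k) :
    (∃ μ : (n * (k + 1)).Partition,
      (k = 1 → Even n → μ.parts = {n + 1, n - 1}) ∧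
      (k = 1 → Odd n → μ.parts = {n, n}) ∧
      (2 ≤ k → Even (n * (k + 1)) →
        μ.parts = {n * (k + 1) / 2 + 1, n * (k + 1) / 2 - 1}) ∧
      (2 ≤ k → Odd (n * (k + 1)) →
        μ.parts = {(n * (k + 1) + 1) / 2, (n * (k + 1) - 1) / 2}) ∧
      ¬ Suns.HasConnectedPartition (Suns.ordinarySun n k) μ ∧
      ¬ Suns.HasConnectedPartition (Suns.completeSun n k) μ) ∧
    ¬ Suns.GraphEPositive (Suns.ordinarySun n k) ∧
    ¬ Suns.GraphEPositive (Suns.completeSun n k) := by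
  have hbig : 3 * (k + 1) ≤ n * (k + 1) := Nat.mul_le_mul_right _ hn
  -- two parts with a difference below `k + 1` are not both divisible by `k + 1`
  have hdiff : ∀ a b, a + b = n * (k + 1) → b < a → a < b + (k + 1) → ¬ k + 1 ∣ a := by
    intro a b hab hlt hlt' ha
    have hb : k + 1 ∣ b := (Nat.dvd_add_right ha).1 (hab ▸ Dvd.intro_left _ rfl)
    have := Nat.le_of_dvd (by omega) (Nat.dvd_sub ha hb)
    omega
  obtain ⟨a, b, hab, ha, hb, hdvd, h1, h2, h3, h4⟩ : ∃ a b : ℕ, a + b = n * (k + 1) ∧ k < a ∧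
      k < b ∧ ¬ k + 1 ∣ a ∧ (k = 1 → Even n → a = n + 1 ∧ b = n - 1) ∧
      (k = 1 → Odd n → a = n ∧ b = n) ∧
      (2 ≤ k → Even (n * (k + 1)) → a = n * (k + 1) / 2 + 1 ∧ b = n * (k + 1) / 2 - 1) ∧
      (2 ≤ k → Odd (n * (k + 1)) →
        a = (n * (k + 1) + 1) / 2 ∧ b = (n * (k + 1) - 1) / 2) := by
    simp only [Nat.even_iff, Nat.odd_iff]
    by_cases hk1 : k = 1
    · subst hk1
      rcases Nat.mod_two_eq_zero_or_one n with hp | hp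
      · exact ⟨n + 1, n - 1, by omega, by omega, by omega, by omega, by omega, by omega,
          by omega, by omega⟩
      · exact ⟨n, n, by omega, by omega, by omega, by omega, by omega, by omega,
          by omega, by omega⟩
    · generalize n * (k + 1) = N at *
      rcases Nat.mod_two_eq_zero_or_one N with hp | hp
      · exact ⟨N / 2 + 1, N / 2 - 1, by omega, by omega, by omega,
          hdiff _ (N / 2 - 1) (by omega) (by omega) (by omega), by omega, by omega, by omega,
          by omega⟩
      · exact ⟨(N + 1) / 2, (N - 1) / 2, by omega, by omega, by omega,
          hdiff _ ((N - 1) / 2) (by omega) (by omega) (by omega), by omega, by omega, by omega,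
          by omega⟩
  have hcycle : (SimpleGraph.cycleGraph n).Connected := by
    obtain ⟨m, rfl⟩ : ∃ m, n = m + 1 := ⟨n - 1, by omega⟩
    exact SimpleGraph.cycleGraph_connected
  have hcomplete : (SimpleGraph.completeGraph (Fin n)).Connected := by
    have : Nonempty (Fin n) := ⟨⟨0, by omega⟩⟩
    exact SimpleGraph.connected_top
  have hparts : ∀ x ∈ ({a, b} : Multiset ℕ), k < x := by
    intro x hx
    simp only [Multiset.insert_eq_cons, Multiset.mem_cons, Multiset.mem_singleton] at hx
    rcases hx with rfl | rfl <;> assumption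
  let μ : (n * (k + 1)).Partition :=
    { parts := {a, b}
      parts_pos := fun {x} hx => (Nat.zero_le k).trans_lt (hparts x hx)
      parts_sum := by simpa using hab }
  refine ⟨⟨μ, ?_, ?_, ?_, ?_, ?_, ?_⟩, ?_, ?_⟩
  · intro h h'
    rw [← (h1 h h').1, ← (h1 h h').2]
  · intro h h'
    change ({a, b} : Multiset ℕ) = _
    rw [(h2 h h').1, (h2 h h').2]
  · intro h h'
    rw [← (h3 h h').1, ← (h3 h h').2]
  · intro h h'
    rw [← (h4 h h').1, ← (h4 h h').2]
  · exact Suns.not_hasConnectedPartition_sun μ hparts (Multiset.mem_cons_self a {b}) hdvd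
  · exact Suns.not_hasConnectedPartition_sun μ hparts (Multiset.mem_cons_self a {b}) hdvd
  · exact Suns.not_graphEPositive_sun hcycle hab ha hb hdvd
  · exact Suns.not_graphEPositive_sun hcomplete hab ha hb hdvd
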